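/- For a finite simple graph $\Gamma=(V,E)$, the transposition game on $\Gamma$ has as positions the permutations of $V$; a move multiplies a permutation by a transposition $(a\,b)$ with $\{a,b\}\in E$ (it swaps the labels at the two ends of an edge). The game graph is the graph on the positions in which two positions are adjacent if they differ by one move, that is, the Cayley graph of the symmetric group of $V$ with respect to the transpositions given by the edges of $\Gamma$. The god number $\mathrm{God}(\Gamma)$ is the diameter of the game graph (infinite if the game graph is disconnected). Then: a) for the complete graph $K_n$ on $n\ge 1$ vertices, $\mathrm{God}(K_n)=n-1$; b) for the path $P_n$ on $n\ge 1$ vertices, $\mathrm{God}(P_n)=n(n-1)/2$; c) for the cycle $C_n$ on $n\ge 3$ vertices, $\mathrm{God}(C_n)=\lfloor (n^2+1)/4\rfloor$; moreover, labelling the vertices cyclically by the residues modulo $n$, the half rotation $\pi(k)=k+\lfloor n/2\rfloor \bmod n$ has distance exactly $\lfloor (n^2+1)/4\rfloor$ from the identity in the game graph; d) for the star with $n\ge 1$ leaves (so $n+1$ vertices), the god number is $\lfloor 3n/2\rfloor$; e) for the wheel with $n\ge 3$ rim vertices (so $n+1$ vertices: a cycle $C_n$ together with a hub joined to all its vertices),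 the god number is at least $n$ and at most $\lfloor 3n/2\rfloor$. -/

import Mathlib

namespace TranspositionGame

/-- The game graph of the transposition game on `Γ`: the positions are the permutations of the
vertex set (`σ v` is the label that lies at the vertex `v`), and a move swaps the labels at the
two ends of an edge of `Γ`. It is the Cayley graph of the symmetric group with respect to the
transpositions given by the edges of `Γ`. -/
def gameGraph {V : Type*} [DecidableEq V] (Γ : SimpleGraph V) : SimpleGraph (Equiv.Perm V) :=
  SimpleGraph.mulCayley {τ : Equiv.Perm V | ∃ a b : V, Γ.Adj a b ∧ τ = Equiv.swap a b}

/-- The god number of the transposition game on `Γ`: the diameter of its game graph. It is `⊤`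
if some position cannot be reached from some other one. -/
noncomputable def godNumber {V : Type*} [DecidableEq V] (Γ : SimpleGraph V) : ℕ∞ :=
  (gameGraph Γ).ediam

/-- The star with `n` leaves `some 0, …, some (n - 1)` and center `none`. -/
def starGraph (n : ℕ) : SimpleGraph (Option (Fin n)) where
  Adj x y := x ≠ y ∧ (x = none ∨ y = none)
  symm := ⟨fun _ _ h => ⟨h.1.symm, h.2.symm⟩⟩
  loopless := ⟨fun _ h => h.1 rfl⟩

/-- The wheel with `n` rim vertices `some 0, …, some (n - 1)`, which form a cycle, and hub `none`,
which is joined to all of them. -/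
def wheelGraph (n : ℕ) : SimpleGraph (Option (Fin n)) :=
  starGraph n ⊔ (SimpleGraph.cycleGraph n).map Function.Embedding.some

/-- The half rotation `k ↦ k + ⌊n / 2⌋ mod n`. -/
def halfRotation (n : ℕ) : Equiv.Perm (Fin n) :=
  finRotate n ^ (n / 2)

theorem halfRotation_apply (n : ℕ) (k : Fin n) :
    (halfRotation n k : ℕ) = (k + n / 2) % n := by
  have key : ∀ m : ℕ, (((finRotate n) ^ m) k : ℕ) = (k + m) % n := by
    intro m
    induction m with
    | zero => simp [Nat.mod_eq_of_lt k.isLt]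
    | succ m ih =>
      obtain _ | n := n
      · exact k.elim0
      · rw [pow_succ', Equiv.Perm.mul_apply, finRotate_apply, Fin.val_add, ih]
        rw [Fin.val_one', ← Nat.add_mod, Nat.add_assoc]
  exact key _

end TranspositionGame

/-! Left multiplication preserves the game graph, so the god number is the largest distance to the
identity (`godNumber_le_iff`). Lower bounds come from an invariant followed along the moves
(`le_edist_one`), upper bounds from strategies that make a counter drop.

The counters are: the size of the support for the complete graph, inversions for the path, wrong
leaves for the star. The wheel contains a star, which bounds it above; the lower bound
`card_sub_one_le_godNumber` holds for every graph.

On the cycle, give each label a signed travel distance `x i`, with total zero and all differences at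
most `n`. The pairs in which one label must overtake the other then form a strict order, and the
number of comparable pairs bounds the distance (`IsDisplacement.edist_le`). In this order `x i` is
the number of elements below `i` minus the number above it (`IsDisplacement.imbalance_eq`), so the
bound on the differences turns the problem into one about orders, solved by `comparableCount_le`.
For the half rotation, the sum of the `|x i|`, which a move changes by at most two, gives the
matching lower bound. -/

namespace TranspositionGame

open Equiv

/-! ### Distances in the game graph of an arbitrary graph -/

section Game

variable {V : Type*} [DecidableEq V] {Γ Γ' : SimpleGraph V}

lemma gameGraph_adj_iff {σ τ : Perm V} :
    (gameGraph Γ).Adj σ τ ↔ ∃ a b, Γ.Adj a b ∧ τ = σ * swap a b := by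
  rw [gameGraph, SimpleGraph.mulCayley_adj']
  constructor
  · rintro ⟨-, g, ⟨a, b, hab, rfl⟩, rfl | rfl⟩
    · exact ⟨a, b, hab, rfl⟩
    · exact ⟨a, b, hab, by rw [mul_swap_mul_self]⟩
  · rintro ⟨a, b, hab, rfl⟩
    refine ⟨fun h => hab.ne ?_, _, ⟨a, b, hab, rfl⟩, Or.inl rfl⟩
    rw [left_eq_mul, swap_eq_one_iff] at h
    exact h

lemma edist_one_le_succ {σ : Perm V} {a b : V} {k : ℕ} (hab : Γ.Adj a b)
    (h : (gameGraph Γ).edist (σ * swap a b) 1 ≤ k) :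
    (gameGraph Γ).edist σ 1 ≤ (k + 1 : ℕ) := by
  have h1 : (gameGraph Γ).edist σ (σ * swap a b) = 1 :=
    SimpleGraph.edist_eq_one_iff_adj.2 (gameGraph_adj_iff.2 ⟨a, b, hab, rfl⟩)
  refine ((gameGraph Γ).edist_triangle (v := σ * swap a b)).trans ?_
  rw [h1, add_comm, Nat.cast_add, Nat.cast_one]
  gcongr

/-- To prove a property of the positions that can be solved in `k` moves, it suffices to prove it
for the solved position and to follow it along a move. -/
lemma walk_induction {P : ℕ → Perm V → Prop} (one : P 0 1)
    (move : ∀ k σ a b, Γ.Adj a b → P k σ → P (k + 1) (σ * swap a b))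
    {σ : Perm V} (w : (gameGraph Γ).Walk σ 1) : P w.length σ := by
  generalize hρ : (1 : Perm V) = ρ at w
  induction w with
  | nil => subst hρ; exact one
  | cons h p ih =>
    obtain ⟨a, b, hab, rfl⟩ := gameGraph_adj_iff.1 h
    have := move _ _ a b hab (ih hρ)
    rwa [mul_swap_mul_self] at this

lemma le_edist_one {P : ℕ → Perm V → Prop} (one : P 0 1)
    (move : ∀ k σ a b, Γ.Adj a b → P k σ → P (k + 1) (σ * swap a b))
    {σ : Perm V} {m : ℕ} (hm : ∀ k, P k σ → m ≤ k) : (m : ℕ∞) ≤ (gameGraph Γ).edist σ 1 :=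
  le_iInf fun w => by exact_mod_cast hm _ (walk_induction one move w)

lemma le_edist_one_of_potential (Φ : Perm V → ℕ) (one : Φ 1 = 0)
    (move : ∀ σ a b, Γ.Adj a b → Φ (σ * swap a b) ≤ Φ σ + 1) (σ : Perm V) :
    (Φ σ : ℕ∞) ≤ (gameGraph Γ).edist σ 1 :=
  le_edist_one (P := fun k σ => Φ σ ≤ k) one.le
    (fun _ σ a b hab h => (move σ a b hab).trans (by omega)) fun _ h => h

lemma edist_mul_left_le (ρ σ τ : Perm V) :
    (gameGraph Γ).edist (ρ * σ) (ρ * τ) ≤ (gameGraph Γ).edist σ τ := by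
  let f : gameGraph Γ →g gameGraph Γ :=
    ⟨fun σ => ρ * σ, fun h => SimpleGraph.mulCayley_adj_mul_iff_right.2 h⟩
  refine le_iInf fun w => ?_
  exact (SimpleGraph.edist_le (w.map f)).trans (by rw [SimpleGraph.Walk.length_map])

/-- Left translation carries any pair of positions to a pair whose second member is the identity. -/
lemma godNumber_le_iff {k : ℕ∞} :
    godNumber Γ ≤ k ↔ ∀ σ : Perm V, (gameGraph Γ).edist σ 1 ≤ k := by
  rw [godNumber, SimpleGraph.ediam_le_iff]
  refine ⟨fun h σ => h σ 1, fun h σ τ => le_trans ?_ (h (τ⁻¹ * σ))⟩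
  simpa using edist_mul_left_le (Γ := Γ) τ (τ⁻¹ * σ) 1

lemma edist_one_le_godNumber (σ : Perm V) : (gameGraph Γ).edist σ 1 ≤ godNumber Γ :=
  SimpleGraph.edist_le_ediam

lemma gameGraph_mono (h : Γ ≤ Γ') : gameGraph Γ ≤ gameGraph Γ' :=
  SimpleGraph.mulCayley_mono fun _ ⟨a, b, hab, hτ⟩ => ⟨a, b, h hab, hτ⟩

lemma godNumber_anti (h : Γ ≤ Γ') : godNumber Γ' ≤ godNumber Γ :=
  godNumber_le_iff.2 fun σ =>
    (SimpleGraph.edist_anti (gameGraph_mono h)).trans (edist_one_le_godNumber σ)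

end Game

/-! ### Complete graphs, and a lower bound for every graph -/

section Complete

variable {V : Type*} [DecidableEq V] [Fintype V]

/-- A full cycle is at distance at least `|V| - 1` from the identity: a product of `k` transpositions
preserves a colouring by at least `|V| - k` colours. -/
lemma card_sub_one_le_edist_one {Γ : SimpleGraph V} {σ : Perm V}
    (hσ : σ.IsCycleOn (Set.univ : Set V)) :
    ((Fintype.card V - 1 : ℕ) : ℕ∞) ≤ (gameGraph Γ).edist σ 1 := by
  refine le_edist_one (P := fun k σ => ∃ f : V → V, (∀ x, f (σ x) = f x) ∧
    Fintype.card V ≤ (Finset.univ.image f).card + k) ⟨id, by simp⟩ ?_ ?_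
  · rintro k σ a b - ⟨f, hf, hk⟩
    -- Merging the colours of `a` and `b` makes the colouring invariant again and costs at most one
    -- colour.
    refine ⟨fun x => if f x = f a then f b else f x, fun x => ?_, ?_⟩
    · rcases eq_or_ne x a with rfl | hxa
      · simp [hf]
      rcases eq_or_ne x b with rfl | hxb
      · simp [hf]
      · simp [hf, swap_apply_of_ne_of_ne hxa hxb]
    · have h1 : (Finset.univ.image f).erase (f a) ⊆
          Finset.univ.image (fun x => if f x = f a then f b else f x) := by
        intro y hy
        obtain ⟨hya, hy⟩ := Finset.mem_erase.1 hy
        obtain ⟨x, -, rfl⟩ := Finset.mem_image.1 hy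
        exact Finset.mem_image.2 ⟨x, Finset.mem_univ _, if_neg hya⟩
      have h2 := Finset.card_le_card h1
      have h3 := Finset.pred_card_le_card_erase (s := Finset.univ.image f) (a := f a)
      omega
  · rintro k ⟨f, hf, hk⟩
    have hpow : ∀ (m : ℤ) x, f ((σ ^ m) x) = f x := by
      intro m
      induction m with
      | zero => simp
      | succ m ih => intro x; rw [zpow_add_one, Perm.mul_apply, ih, hf]
      | pred m ih =>
        intro x
        rw [zpow_sub_one, Perm.mul_apply, ih, ← hf (σ⁻¹ x), Perm.inv_def, apply_symm_apply]
    have hc : (Finset.univ.image f).card ≤ 1 := by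
      refine Finset.card_le_one.2 ?_
      simp only [Finset.mem_image, Finset.mem_univ, true_and, forall_exists_index,
        forall_apply_eq_imp_iff]
      intro x y
      obtain ⟨m, hm⟩ := hσ.2 (Set.mem_univ x) (Set.mem_univ y)
      rw [← hm, hpow]
    omega

lemma card_sub_one_le_godNumber (Γ : SimpleGraph V) :
    ((Fintype.card V - 1 : ℕ) : ℕ∞) ≤ godNumber Γ := by
  obtain ⟨σ, hσ, -⟩ := (Finset.univ : Finset V).exists_cycleOn
  rw [Finset.coe_univ] at hσ
  exact (card_sub_one_le_edist_one hσ).trans (edist_one_le_godNumber σ)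

/-- Swapping `a` with the vertex that carries the label `a` fixes `a` and disturbs no fixed vertex.
The bound has `m + 1` because no support has exactly one element: the last swap fixes two vertices.
-/
lemma edist_one_le_of_card_support_le (m : ℕ) (σ : Perm V) (h : σ.support.card ≤ m + 1) :
    (gameGraph (⊤ : SimpleGraph V)).edist σ 1 ≤ m := by
  induction m generalizing σ with
  | zero =>
    have : σ = 1 := by
      by_contra hne
      have := Perm.two_le_card_support_of_ne_one hne
      omega
    simp [this]
  | succ m ih =>
    rcases eq_or_ne σ 1 with rfl | hne
    · simp
    obtain ⟨a, ha⟩ : ∃ a, σ a ≠ a := by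
      by_contra! hall
      exact hne (Perm.ext hall)
    have hab : a ≠ σ.symm a := fun hh => ha ((symm_apply_eq σ).1 hh.symm).symm
    refine edist_one_le_succ (a := a) (b := σ.symm a) hab (ih _ ?_)
    have hsub : (σ * swap a (σ.symm a)).support ⊆ σ.support.erase a := by
      intro x hx
      rw [Perm.mem_support, Perm.mul_apply] at hx
      rw [Finset.mem_erase, Perm.mem_support]
      rcases eq_or_ne x a with rfl | hxa
      · simp at hx
      refine ⟨hxa, ?_⟩
      rcases eq_or_ne x (σ.symm a) with rfl | hxb
      · rw [apply_symm_apply]; exact hab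
      · rwa [swap_apply_of_ne_of_ne hxa hxb] at hx
    have h1 := Finset.card_le_card hsub
    rw [Finset.card_erase_of_mem (Perm.mem_support.2 ha)] at h1
    omega

/-- The god number of a complete graph. -/
theorem godNumber_top [Nonempty V] :
    godNumber (⊤ : SimpleGraph V) = ((Fintype.card V - 1 : ℕ) : ℕ∞) := by
  refine le_antisymm (godNumber_le_iff.2 fun σ => edist_one_le_of_card_support_le _ σ ?_)
    (card_sub_one_le_godNumber _)
  rw [Nat.sub_add_cancel Fintype.card_pos]
  exact Finset.card_le_univ _

end Complete

/-! ### Comparable pairs in a finite strict order -/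

section Order

open Finset

variable {α : Type*} (r : α → α → Prop) [DecidableRel r]

/-- The number of elements of `s` that lie below `i` minus the number of those above it. -/
def imbalance (s : Finset α) (i : α) : ℤ :=
  (#{j ∈ s | r i j} : ℤ) - #{j ∈ s | r j i}

/-- The number of comparable pairs in `s`. -/
def comparableCount (s : Finset α) : ℕ := ∑ i ∈ s, #{j ∈ s | r i j}

variable {r}

/-- By transitivity `i` has everything below it that `j` has, and also `j`; dually for the elements
above. Each of the two counts contributes one. -/
lemma imbalance_add_two_le [Std.Irrefl r] [IsTrans α r] {s : Finset α} {i j : α} (hi : i ∈ s)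
    (hj : j ∈ s) (h : r i j) : imbalance r s j + 2 ≤ imbalance r s i := by
  have h1 : #{k ∈ s | r j k} < #{k ∈ s | r i k} := by
    refine card_lt_card ((ssubset_iff_of_subset ?_).2 ⟨j, ?_⟩)
    · exact monotone_filter_right _ fun k _ hk => _root_.trans h hk
    · simp [hj, h, irrefl_of r j]
  have h2 : #{k ∈ s | r k i} < #{k ∈ s | r k j} := by
    refine card_lt_card ((ssubset_iff_of_subset ?_).2 ⟨i, ?_⟩)
    · exact monotone_filter_right _ fun k _ hk => _root_.trans hk h
    · simp [hi, h, irrefl_of r i]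
  unfold imbalance
  omega

variable [DecidableEq α]

lemma card_filter_erase (p : α → Prop) [DecidablePred p] {s : Finset α} {t : α} (ht : t ∈ s) :
    #{j ∈ s.erase t | p j} + (if p t then 1 else 0) = #{j ∈ s | p j} := by
  rw [card_filter, card_filter, sum_erase_add _ _ ht]

/-- A finite strictly ordered set of `n` elements in which the imbalances differ by at most `n` has
at most `n ^ 2 / 4` comparable pairs. -/
theorem comparableCount_le [Std.Irrefl r] [IsTrans α r] (n : ℕ) (s : Finset α) (hn : #s = n)
    (hs : ∀ i ∈ s, ∀ j ∈ s, imbalance r s i - imbalance r s j ≤ n) :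
    4 * comparableCount r s ≤ n ^ 2 := by
  induction n using Nat.strong_induction_on generalizing s with
  | _ n ih =>
  by_cases hE : ∀ i ∈ s, ∀ j ∈ s, ¬ r i j
  · have : comparableCount r s = 0 :=
      sum_eq_zero fun i hi => card_eq_zero.2 (filter_eq_empty_iff.2 fun j hj => hE i hi j hj)
    simp [this]
  push Not at hE
  obtain ⟨i₀, hi₀, j₀, hj₀, hr₀⟩ := hE
  obtain ⟨t, ht, htmax⟩ := s.exists_max_image (imbalance r s) ⟨i₀, hi₀⟩
  obtain ⟨b, hb, hbmin⟩ := s.exists_min_image (imbalance r s) ⟨i₀, hi₀⟩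
  have hlt : imbalance r s b < imbalance r s t := by
    have := imbalance_add_two_le hi₀ hj₀ hr₀
    have := htmax i₀ hi₀
    have := hbmin j₀ hj₀
    omega
  have htb : t ≠ b := by rintro rfl; exact lt_irrefl _ hlt
  -- Extreme imbalance implies extremality in the order: `t` is maximal and `b` is minimal. Both
  -- will be removed.
  have hup : ∀ t' ∈ s, imbalance r s t ≤ imbalance r s t' → ∀ k ∈ s, ¬ r k t' := by
    intro t' ht' hle k hk h
    have := imbalance_add_two_le hk ht' h
    have := htmax k hk
    omega
  have hdown : ∀ b' ∈ s, imbalance r s b' ≤ imbalance r s b → ∀ k ∈ s, ¬ r b' k := by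
    intro b' hb' hle k hk h
    have := imbalance_add_two_le hb' hk h
    have := hbmin k hk
    omega
  -- the imbalance of a maximal and of a minimal element
  have hxt : ∀ t' ∈ s, imbalance r s t ≤ imbalance r s t' →
      imbalance r s t' = #{j ∈ s | r t' j} := by
    intro t' ht' hle
    rw [imbalance, filter_eq_empty_iff.2 (hup t' ht' hle)]
    simp
  have hxb : ∀ b' ∈ s, imbalance r s b' ≤ imbalance r s b →
      imbalance r s b' = - #{j ∈ s | r j b'} := by
    intro b' hb' hle
    rw [imbalance, filter_eq_empty_iff.2 (hdown b' hb' hle)]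
    simp
  -- incomparable extremal elements force a small range
  have hinc : ∀ t' ∈ s, ∀ b' ∈ s, imbalance r s t ≤ imbalance r s t' →
      imbalance r s b' ≤ imbalance r s b → ¬ r t' b' →
      imbalance r s t - imbalance r s b ≤ n - 2 := by
    intro t' ht' b' hb' hlt' hlb' hrel
    have htb' : t' ≠ b' := by rintro rfl; omega
    -- A common element would give `r t' b'` by transitivity. Both sets also avoid `t'` and `b'`, so
    -- together they have at most `n - 2` elements.
    have hdis : Disjoint {j ∈ s | r t' j} {j ∈ s | r j b'} :=
      disjoint_filter.2 fun k _ h1 h2 => hrel (_root_.trans h1 h2)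
    have hsub : {j ∈ s | r t' j} ∪ {j ∈ s | r j b'} ⊆ (s.erase t').erase b' := by
      intro k hk
      simp only [mem_union, mem_filter] at hk
      simp only [mem_erase]
      rcases hk with ⟨hk, h⟩ | ⟨hk, h⟩
      · exact ⟨by rintro rfl; exact hrel h, by rintro rfl; exact irrefl_of r _ h, hk⟩
      · exact ⟨by rintro rfl; exact irrefl_of r _ h, by rintro rfl; exact hrel h, hk⟩
    have hcard := card_le_card hsub
    rw [card_union_of_disjoint hdis, card_erase_of_mem (mem_erase.2 ⟨htb'.symm, hb'⟩),
      card_erase_of_mem ht', hn] at hcard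
    have h2 : 1 < #s := one_lt_card.2 ⟨t', ht', b', hb', htb'⟩
    have e1 := hxt t' ht' hlt'
    have e2 := hxb b' hb' hlb'
    have e3 := htmax t' ht'
    have e4 := hbmin b' hb'
    omega
  set s' := (s.erase t).erase b with hs'
  have hbt : b ∈ s.erase t := mem_erase.2 ⟨htb.symm, hb⟩
  have h2 : 1 < #s := one_lt_card.2 ⟨t, ht, b, hb, htb⟩
  have hcard : #s' = n - 2 := by
    rw [hs', card_erase_of_mem hbt, card_erase_of_mem ht, hn]; omega
  have hfil : ∀ (p : α → Prop) [DecidablePred p],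
      #{j ∈ s' | p j} + (if p b then 1 else 0) + (if p t then 1 else 0) = #{j ∈ s | p j} := by
    intro p _
    rw [hs', card_filter_erase p hbt, card_filter_erase p ht]
  -- the imbalance after the removal of `t` and `b`
  have himb : ∀ i ∈ s, imbalance r s' i =
      imbalance r s i - (if r i b then 1 else 0) + (if r t i then 1 else 0) := by
    intro i hi
    have e1 := hfil (fun j => r i j)
    have e2 := hfil (fun j => r j i)
    simp only [hup t ht le_rfl i hi, hdown b hb le_rfl i hi, if_false] at e1 e2
    unfold imbalance
    rw [← e1, ← e2]
    push_cast
    ring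
  -- The pair `(t, b)`, if comparable, is counted both below `t` and above `b`.
  have hcount : comparableCount r s + (if r t b then 1 else 0) =
      comparableCount r s' + #{j ∈ s | r t j} + #{j ∈ s | r j b} := by
    have e0 : comparableCount r s = ∑ i ∈ s', #{j ∈ s | r i j} + #{j ∈ s | r b j} +
        #{j ∈ s | r t j} := by
      rw [comparableCount, hs', sum_erase_add _ _ hbt, sum_erase_add _ _ ht]
    have e1 : #{j ∈ s | r b j} = 0 :=
      card_eq_zero.2 (filter_eq_empty_iff.2 (hdown b hb le_rfl))
    have e2 : ∑ i ∈ s', #{j ∈ s | r i j} = comparableCount r s' + #{j ∈ s' | r j b} := by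
      rw [comparableCount, card_filter (fun j => r j b), ← sum_add_distrib]
      refine sum_congr rfl fun i hi => ?_
      have hi : i ∈ s := mem_of_mem_erase (mem_of_mem_erase hi)
      have := hfil (fun j => r i j)
      simp only [hup t ht le_rfl i hi, if_false] at this
      exact this.symm
    have e3 := hfil (fun j => r j b)
    simp only [irrefl_of r b, if_false] at e3
    rw [e0, e1, e2]
    omega
  have ext := hxt t ht le_rfl
  have exb := hxb b hb le_rfl
  have hR := hs t ht b hb
  have hsub : ∀ i ∈ s', i ∈ s := fun i hi => mem_of_mem_erase (mem_of_mem_erase hi)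
  -- An element below `t` has imbalance at least two smaller, so the one it gains by the removal of
  -- `t` is harmless.
  have hle_t : ∀ i ∈ s, imbalance r s' i ≤ imbalance r s t := by
    intro i hi
    rw [himb i hi]
    by_cases h : r t i
    · have := imbalance_add_two_le ht hi h
      split_ifs <;> omega
    · have := htmax i hi
      split_ifs <;> omega
  have hb_le : ∀ i ∈ s, imbalance r s b ≤ imbalance r s' i := by
    intro i hi
    rw [himb i hi]
    by_cases h : r i b
    · have := imbalance_add_two_le hi hb h
      split_ifs <;> omega
    · have := hbmin i hi
      split_ifs <;> omega
  obtain ⟨m, rfl⟩ : ∃ m, n = m + 2 := ⟨n - 2, by omega⟩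
  -- The induction closes because `m ^ 2 + 4 * (m + 1) = (m + 2) ^ 2`.
  have key : (∀ i ∈ s', ∀ j ∈ s', imbalance r s' i - imbalance r s' j ≤ m) ∧
      comparableCount r s ≤ comparableCount r s' + m + 1 := by
    by_cases hsmall : imbalance r s t - imbalance r s b ≤ m
    · refine ⟨fun i hi j hj => ?_, by split_ifs at hcount <;> omega⟩
      have := hle_t i (hsub i hi)
      have := hb_le j (hsub j hj)
      omega
    -- If the range exceeds `n - 2`, every element of maximal imbalance lies above every element of
    -- minimal imbalance. The removal then pulls both ends of the range in by one.
    · have hrel : ∀ t' ∈ s, ∀ b' ∈ s, imbalance r s t ≤ imbalance r s t' →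
          imbalance r s b' ≤ imbalance r s b → r t' b' := by
        intro t' ht' b' hb' h1 h2
        by_contra h
        have := hinc t' ht' b' hb' h1 h2 h
        push_cast at this
        omega
      have hrtb := hrel t ht b hb le_rfl le_rfl
      rw [if_pos hrtb] at hcount
      refine ⟨fun i hi j hj => ?_, by push_cast at hR; omega⟩
      have h1 : imbalance r s' i ≤ imbalance r s t - 1 := by
        rw [himb i (hsub i hi)]
        by_cases h : r t i
        · have := imbalance_add_two_le ht (hsub i hi) h
          split_ifs <;> omega
        · have := htmax i (hsub i hi)
          by_cases h' : imbalance r s t ≤ imbalance r s i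
          · rw [if_pos (hrel i (hsub i hi) b hb h' le_rfl), if_neg h]
            omega
          · split_ifs <;> omega
      have h2 : imbalance r s b + 1 ≤ imbalance r s' j := by
        rw [himb j (hsub j hj)]
        by_cases h : r j b
        · have := imbalance_add_two_le (hsub j hj) hb h
          split_ifs <;> omega
        · have := hbmin j (hsub j hj)
          by_cases h' : imbalance r s j ≤ imbalance r s b
          · rw [if_pos (hrel t ht j (hsub j hj) le_rfl h'), if_neg h]
            omega
          · split_ifs <;> omega
      push_cast at hR
      omega
  have := ih m (by omega) s' (by omega) key.1
  nlinarith [key.2]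

end Order

/-! ### Stars and wheels -/

section Star

open Finset

variable {n : ℕ}

/-- The leaves of the star on which a wrong label lies. -/
def movedLeaves (σ : Perm (Option (Fin n))) : Finset (Fin n) := {l | σ (some l) ≠ some l}

lemma mem_movedLeaves {σ : Perm (Option (Fin n))} {l : Fin n} :
    l ∈ movedLeaves σ ↔ σ (some l) ≠ some l := by
  simp [movedLeaves]

lemma starGraph_adj_center (v : Fin n) : (starGraph n).Adj none (some v) :=
  ⟨by simp, Or.inl rfl⟩

lemma mul_swap_center_apply_of_ne (σ : Perm (Option (Fin n))) {a l : Fin n} (h : l ≠ a) :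
    (σ * swap none (some a)) (some l) = σ (some l) := by
  rw [Perm.mul_apply, swap_apply_of_ne_of_ne (by simp) (by simpa using h)]

lemma mul_swap_center_apply_self (σ : Perm (Option (Fin n))) (a : Fin n) :
    (σ * swap none (some a)) (some a) = σ none := by
  simp

lemma mul_swap_center_apply_none (σ : Perm (Option (Fin n))) (a : Fin n) :
    (σ * swap none (some a)) none = σ (some a) := by
  simp

lemma mem_movedLeaves_of_center {σ : Perm (Option (Fin n))} {v : Fin n} (h : σ none = some v) :
    v ∈ movedLeaves σ :=
  mem_movedLeaves.2 fun h' => by simpa using σ.injective (h'.trans h.symm)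

lemma movedLeaves_mul_swap_of_center {σ : Perm (Option (Fin n))} {v : Fin n}
    (h : σ none = some v) :
    movedLeaves (σ * swap none (some v)) = (movedLeaves σ).erase v := by
  ext l
  rw [mem_movedLeaves, mem_erase, mem_movedLeaves]
  rcases eq_or_ne l v with rfl | hl
  · simp [h]
  · rw [mul_swap_center_apply_of_ne σ hl]
    simp [hl]

/-- A leaf label at the center goes home in one move. If the center is right, an extra move opens a
cycle; that cycle contains at least two wrong leaves, so the extra cost is at most half a move per
wrong leaf. -/
lemma edist_one_le_of_card_movedLeaves (m : ℕ) (σ : Perm (Option (Fin n)))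
    (hm : #(movedLeaves σ) = m) :
    (σ none ≠ none → (gameGraph (starGraph n)).edist σ 1 ≤ ((3 * m - 1) / 2 : ℕ)) ∧
      (gameGraph (starGraph n)).edist σ 1 ≤ (3 * m / 2 : ℕ) := by
  induction m using Nat.strong_induction_on generalizing σ with
  | _ m ih =>
  -- bring the label at the center home
  have hcenter : ∀ ρ : Perm (Option (Fin n)), ∀ v, ρ none = some v → #(movedLeaves ρ) = m →
      0 < m ∧ #(movedLeaves (ρ * swap none (some v))) = m - 1 := by
    intro ρ v hv hρ
    have hmem := mem_movedLeaves_of_center hv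
    rw [movedLeaves_mul_swap_of_center hv, card_erase_of_mem hmem, hρ]
    exact ⟨hρ ▸ card_pos.2 ⟨v, hmem⟩, rfl⟩
  by_cases hc : σ none = none
  · refine ⟨fun h => absurd hc h, ?_⟩
    rcases (movedLeaves σ).eq_empty_or_nonempty with he | ⟨a, ha⟩
    · have : σ = 1 := by
        ext1 x
        rcases x with _ | l
        · exact hc
        · by_contra h
          exact notMem_empty l (he ▸ mem_movedLeaves.2 h)
      simp [this]
    have ha' := mem_movedLeaves.1 ha
    obtain ⟨b, hb⟩ : ∃ b, σ (some a) = some b := by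
      refine Option.ne_none_iff_exists'.1 fun h => ?_
      simpa using σ.injective (h.trans hc.symm)
    have hba : b ≠ a := by rintro rfl; exact ha' hb
    set σ₁ := σ * swap none (some a) with hσ₁
    have h₁ : σ₁ none = some b := by rw [hσ₁, mul_swap_center_apply_none, hb]
    have hm₁ : #(movedLeaves σ₁) = m := by
      rw [← hm]
      congr 1
      ext l
      rw [mem_movedLeaves, mem_movedLeaves]
      rcases eq_or_ne l a with rfl | hl
      · rw [hσ₁, mul_swap_center_apply_self, hc]
        simp [ha']
      · rw [hσ₁, mul_swap_center_apply_of_ne σ hl]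
    obtain ⟨hpos, hm₂⟩ := hcenter σ₁ b h₁ hm₁
    have h₂ : (σ₁ * swap none (some b)) none ≠ none := by
      rw [mul_swap_center_apply_none, hσ₁, mul_swap_center_apply_of_ne σ hba]
      exact fun h => by simpa using σ.injective (h.trans hc.symm)
    -- A second wrong leaf remains; otherwise the subtraction in `3 * (m - 1) - 1` would truncate
    -- and the count would fail.
    have hm1 : 0 < m - 1 := by
      obtain ⟨c, hc'⟩ := Option.ne_none_iff_exists'.1 h₂
      rw [← hm₂]
      exact card_pos.2 ⟨c, mem_movedLeaves_of_center hc'⟩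
    have := edist_one_le_succ (starGraph_adj_center a)
      (edist_one_le_succ (starGraph_adj_center b) ((ih (m - 1) (by omega) _ hm₂).1 h₂))
    convert this using 2
    omega
  · obtain ⟨v, hv⟩ := Option.ne_none_iff_exists'.1 hc
    obtain ⟨hpos, hm'⟩ := hcenter σ v hv hm
    have := edist_one_le_succ (starGraph_adj_center v) (ih (m - 1) (by omega) _ hm').2
    have h1 : (gameGraph (starGraph n)).edist σ 1 ≤ ((3 * m - 1) / 2 : ℕ) := by
      convert this using 2
      omega
    exact ⟨fun _ => h1, h1.trans (by gcongr; omega)⟩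

/-- The smaller leaves of the pairs of leaves whose labels are interchanged. -/
def swappedLeaves (σ : Perm (Option (Fin n))) : Finset (Fin n) :=
  {l | ∃ l', l < l' ∧ σ (some l) = some l' ∧ σ (some l') = some l}

lemma mem_swappedLeaves {σ : Perm (Option (Fin n))} {l : Fin n} :
    l ∈ swappedLeaves σ ↔ ∃ l', l < l' ∧ σ (some l) = some l' ∧ σ (some l') = some l := by
  simp [swappedLeaves]

lemma eq_or_apply_eq_of_mem_swappedLeaves_sdiff {σ : Perm (Option (Fin n))} {a l : Fin n}
    (h : l ∈ swappedLeaves (σ * swap none (some a)) \ swappedLeaves σ) :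
    l = a ∨ (l < a ∧ (σ * swap none (some a)) (some l) = some a ∧ σ none = some l) := by
  obtain ⟨h1, h2⟩ := mem_sdiff.1 h
  obtain ⟨l', hlt, e1, e2⟩ := mem_swappedLeaves.1 h1
  rcases eq_or_ne l a with rfl | hla
  · exact Or.inl rfl
  rcases eq_or_ne l' a with rfl | hla'
  · rw [mul_swap_center_apply_self] at e2
    exact Or.inr ⟨hlt, e1, e2⟩
  · rw [mul_swap_center_apply_of_ne σ hla] at e1
    rw [mul_swap_center_apply_of_ne σ hla'] at e2
    exact absurd (mem_swappedLeaves.2 ⟨l', hlt, e1, e2⟩) h2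

/-- If the leaf `a` is right, its label goes to the center and no interchanged pair arises. If it is
wrong, no new leaf becomes wrong, and a new interchanged pair must contain `a`. -/
lemma card_movedLeaves_add_card_swappedLeaves_le (σ : Perm (Option (Fin n))) (a : Fin n) :
    #(movedLeaves (σ * swap none (some a))) + #(swappedLeaves (σ * swap none (some a))) ≤
      #(movedLeaves σ) + #(swappedLeaves σ) + 1 := by
  set τ := σ * swap none (some a) with hτ
  have hm : movedLeaves τ ⊆ insert a (movedLeaves σ) := by
    intro l hl
    rw [mem_insert, mem_movedLeaves]
    rcases eq_or_ne l a with rfl | hla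
    · exact Or.inl rfl
    · rw [mem_movedLeaves, mul_swap_center_apply_of_ne σ hla] at hl
      exact Or.inr hl
  by_cases ha : σ (some a) = some a
  · have hs : swappedLeaves τ ⊆ swappedLeaves σ := by
      intro l hl
      by_contra hl'
      rcases eq_or_apply_eq_of_mem_swappedLeaves_sdiff (mem_sdiff.2 ⟨hl, hl'⟩) with
        rfl | ⟨hlt, e, -⟩
      · obtain ⟨l', hlt, -, e2⟩ := mem_swappedLeaves.1 hl
        rw [mul_swap_center_apply_of_ne σ hlt.ne'] at e2
        exact hlt.ne' (by simpa using σ.injective (e2.trans ha.symm))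
      · rw [mul_swap_center_apply_of_ne σ hlt.ne] at e
        exact hlt.ne (by simpa using σ.injective (e.trans ha.symm))
    have h1 := card_le_card hm
    have h2 := card_le_card hs
    have h3 := card_insert_le a (movedLeaves σ)
    omega
  · rw [insert_eq_of_mem (mem_movedLeaves.2 ha)] at hm
    have hs : #(swappedLeaves τ \ swappedLeaves σ) ≤ 1 := by
      refine card_le_one.2 fun l hl k hk => ?_
      -- If the center held the label of a smaller leaf `k`, then `k` is the only possible partner
      -- of `a`, so `a` is not the smaller leaf of a pair.
      have aux : ∀ k, k < a → σ none = some k → a ∉ swappedLeaves τ := by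
        intro k hk e h
        obtain ⟨l', hlt, e1, -⟩ := mem_swappedLeaves.1 h
        rw [hτ, mul_swap_center_apply_self, e, Option.some_inj] at e1
        exact absurd (hk.trans hlt) (e1 ▸ lt_irrefl _)
      rcases eq_or_apply_eq_of_mem_swappedLeaves_sdiff hl with rfl | ⟨h1, e1, e1'⟩ <;>
        rcases eq_or_apply_eq_of_mem_swappedLeaves_sdiff hk with rfl | ⟨h2, e2, e2'⟩
      · rfl
      · exact absurd (mem_sdiff.1 hl).1 (aux k h2 e2')
      · exact absurd (mem_sdiff.1 hk).1 (aux l h1 e1')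
      · exact Option.some_inj.1 (e1'.symm.trans e2')
    have h1 := card_le_card hm
    have h2 := card_le_card_sdiff_add_card (s := swappedLeaves τ) (t := swappedLeaves σ)
    omega

lemma card_movedLeaves_add_card_swappedLeaves_le_edist (σ : Perm (Option (Fin n))) :
    ((#(movedLeaves σ) + #(swappedLeaves σ) : ℕ) : ℕ∞) ≤
      (gameGraph (starGraph n)).edist σ 1 := by
  refine le_edist_one_of_potential (fun σ => #(movedLeaves σ) + #(swappedLeaves σ)) ?_ ?_ σ
  · have : swappedLeaves (1 : Perm (Option (Fin n))) = ∅ := by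
      refine eq_empty_of_forall_notMem fun l hl => ?_
      obtain ⟨l', hlt, e, -⟩ := mem_swappedLeaves.1 hl
      exact hlt.ne (by simpa using e)
    simp [movedLeaves, this]
  · rintro σ a b ⟨hne, rfl | rfl⟩
    · obtain ⟨b, rfl⟩ := Option.ne_none_iff_exists'.1 hne.symm
      exact card_movedLeaves_add_card_swappedLeaves_le σ b
    · obtain ⟨a, rfl⟩ := Option.ne_none_iff_exists'.1 hne
      rw [swap_comm]
      exact card_movedLeaves_add_card_swappedLeaves_le σ a

/-- The map that interchanges the leaves `2 * k` and `2 * k + 1`, and the last leaf with the center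
if the number of leaves is odd. -/
def pairUpFun (n : ℕ) : Option (Fin n) → Option (Fin n)
  | none => if h : n % 2 = 1 then some ⟨n - 1, by omega⟩ else none
  | some l =>
    if l.val % 2 = 1 then some ⟨l - 1, by omega⟩
    else if h : l.val + 1 < n then some ⟨l + 1, h⟩ else none

lemma pairUpFun_involutive (n : ℕ) : Function.Involutive (pairUpFun n) := by
  rintro (_ | ⟨l, hl⟩)
  · by_cases h : n % 2 = 1
    · have h1 : (n - 1) % 2 ≠ 1 := by omega
      have h2 : ¬ n - 1 + 1 < n := by omega
      simp [pairUpFun, h, h1, h2]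
    · simp [pairUpFun, h]
  · by_cases h : l % 2 = 1
    · have h1 : (l - 1) % 2 ≠ 1 := by omega
      have h2 : l - 1 + 1 < n := by omega
      have h3 : l - 1 + 1 = l := by omega
      simp only [pairUpFun, h, h1, if_true, if_false, h3, dif_pos hl]
    · by_cases h2 : l + 1 < n
      · have h1 : (l + 1) % 2 = 1 := by omega
        simp only [pairUpFun, h, h1, if_true, if_false, dif_pos h2, Nat.add_sub_cancel]
      · have h1 : n % 2 = 1 := by omega
        have h3 : n - 1 = l := by omega
        simp only [pairUpFun, h, if_false, dif_neg h2, dif_pos h1, h3]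

lemma pairUpFun_ne (l : Fin n) : pairUpFun n (some l) ≠ some l := by
  intro h
  simp only [pairUpFun] at h
  split_ifs at h <;> simp only [Option.some_inj, Fin.ext_iff] at h <;> omega

/-- The god number of a star. -/
theorem godNumber_starGraph (n : ℕ) : godNumber (starGraph n) = ((3 * n / 2 : ℕ) : ℕ∞) := by
  refine le_antisymm (godNumber_le_iff.2 fun σ => ?_) ?_
  · refine (edist_one_le_of_card_movedLeaves _ σ rfl).2.trans ?_
    have := card_le_univ (movedLeaves σ)
    rw [Fintype.card_fin] at this
    gcongr
  · obtain ⟨τ, hτ⟩ : ∃ τ : Perm (Option (Fin n)), ∀ x, τ x = pairUpFun n x :=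
      ⟨(pairUpFun_involutive n).toPerm, fun _ => rfl⟩
    refine le_trans ?_ ((card_movedLeaves_add_card_swappedLeaves_le_edist τ).trans
      (edist_one_le_godNumber τ))
    have h1 : movedLeaves τ = univ := by
      ext l
      simpa [mem_movedLeaves, hτ] using pairUpFun_ne l
    have h2 : n / 2 ≤ #(swappedLeaves τ) := by
      let f : Fin (n / 2) → Fin n := fun k => ⟨2 * k, by omega⟩
      have hf : Function.Injective f := fun a b hab => by
        simp only [f, Fin.ext_iff] at hab ⊢
        omega
      have : univ.image f ⊆ swappedLeaves τ := by
        intro l hl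
        obtain ⟨k, -, rfl⟩ := mem_image.1 hl
        have hk : 2 * k.val + 1 < n := by omega
        have e : pairUpFun n (some (f k)) = some ⟨2 * k + 1, hk⟩ := by
          simp [pairUpFun, f, hk]
        refine mem_swappedLeaves.2 ⟨⟨2 * k + 1, hk⟩, Fin.lt_def.2 (by simp [f]), (hτ _).trans e, ?_⟩
        rw [hτ, ← e, pairUpFun_involutive]
      have := card_le_card this
      rwa [card_image_of_injective _ hf, card_univ, Fintype.card_fin] at this
    rw [h1, card_univ, Fintype.card_fin]
    gcongr
    omega

theorem godNumber_wheelGraph_le (n : ℕ) : godNumber (wheelGraph n) ≤ ((3 * n / 2 : ℕ) : ℕ∞) :=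
  (godNumber_anti le_sup_left).trans (godNumber_starGraph n).le

theorem le_godNumber_wheelGraph (n : ℕ) : (n : ℕ∞) ≤ godNumber (wheelGraph n) := by
  simpa using card_sub_one_le_godNumber (wheelGraph n)

end Star

/-! ### Paths and inversions -/

section Path

open Finset

variable {n : ℕ}

/-- The inversions of a permutation of `Fin n`. -/
def inversions (σ : Perm (Fin n)) : Finset (Fin n × Fin n) :=
  {p | p.1 < p.2 ∧ σ p.2 < σ p.1}

lemma swap_lt_swap_iff {k k' i j : Fin n} (hk : k.val + 1 = k'.val) (h : (i, j) ≠ (k, k'))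
    (h' : (i, j) ≠ (k', k)) : swap k k' i < swap k k' j ↔ i < j := by
  simp only [ne_eq, Prod.mk.injEq, not_and, Fin.ext_iff] at h h'
  simp only [swap_apply_def, Fin.lt_def, Fin.ext_iff]
  split_ifs <;> omega

/-- The inversions of `σ * swap k k'`, relabelled by `swap k k'`. -/
lemma card_inversions_mul_swap (σ : Perm (Fin n)) (k k' : Fin n) :
    #(inversions (σ * swap k k')) =
      #({p | swap k k' p.1 < swap k k' p.2 ∧ σ p.2 < σ p.1} : Finset (Fin n × Fin n)) := by
  refine card_equiv ((swap k k').prodCongr (swap k k')) fun p => ?_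
  rw [inversions, mem_filter, mem_filter]
  simp

lemma card_inversions_mul_swap_le (σ : Perm (Fin n)) {k k' : Fin n} (hk : k.val + 1 = k'.val) :
    #(inversions (σ * swap k k')) ≤ #(inversions σ) + 1 := by
  rw [card_inversions_mul_swap]
  refine (card_le_card (t := insert (k', k) (inversions σ)) ?_).trans (card_insert_le _ _)
  rintro ⟨i, j⟩ hp
  simp only [mem_filter, mem_univ, true_and] at hp
  rw [mem_insert]
  by_contra! h
  rcases eq_or_ne (i, j) (k, k') with h' | h'
  · obtain ⟨rfl, rfl⟩ := Prod.mk.injEq _ _ _ _ ▸ h'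
    rw [swap_apply_left, swap_apply_right, Fin.lt_def] at hp
    omega
  · rw [swap_lt_swap_iff hk h' h.1] at hp
    exact h.2 (by simpa [inversions] using hp)

lemma card_inversions_mul_swap_add_one_le (σ : Perm (Fin n)) {k k' : Fin n}
    (hk : k.val + 1 = k'.val) (hσ : σ k' < σ k) :
    #(inversions (σ * swap k k')) + 1 ≤ #(inversions σ) := by
  have hmem : (k, k') ∈ inversions σ := by
    simp only [inversions, mem_filter, mem_univ, true_and]
    exact ⟨Fin.lt_def.2 (by omega), hσ⟩
  rw [card_inversions_mul_swap, ← card_erase_add_one hmem]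
  gcongr
  rintro ⟨i, j⟩ hp
  simp only [mem_filter, mem_univ, true_and] at hp
  have h1 : (i, j) ≠ (k, k') := by
    rintro h
    obtain ⟨rfl, rfl⟩ := Prod.mk.injEq _ _ _ _ ▸ h
    rw [swap_apply_left, swap_apply_right, Fin.lt_def] at hp
    omega
  have h2 : (i, j) ≠ (k', k) := by
    rintro h
    obtain ⟨rfl, rfl⟩ := Prod.mk.injEq _ _ _ _ ▸ h
    exact lt_asymm hσ hp.2
  rw [swap_lt_swap_iff hk h1 h2] at hp
  exact mem_erase.2 ⟨h1, by simpa [inversions] using hp⟩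

lemma exists_descent {σ : Perm (Fin n)} (hσ : σ ≠ 1) :
    ∃ k k' : Fin n, k.val + 1 = k'.val ∧ σ k' < σ k := by
  by_contra! h
  refine hσ (Perm.ext fun x => ?_)
  have hmono : StrictMono σ := by
    obtain _ | n := n
    · exact fun a => a.elim0
    refine Fin.strictMono_iff_lt_succ.2 fun i => lt_of_le_of_ne (h _ _ (by simp)) ?_
    exact fun he => i.castSucc_lt_succ.ne (σ.injective he)
  -- Two strictly monotone maps on `Fin n` with the same range are equal.
  exact congrFun ((hmono.range_inj strictMono_id).1 (by simp)) x

lemma edist_pathGraph_le (σ : Perm (Fin n)) :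
    (gameGraph (SimpleGraph.pathGraph n)).edist σ 1 ≤ #(inversions σ) := by
  induction hN : #(inversions σ) using Nat.strong_induction_on generalizing σ with
  | _ N ih =>
  rcases eq_or_ne σ 1 with rfl | hσ
  · simp
  obtain ⟨k, k', hk, hlt⟩ := exists_descent hσ
  have hle := card_inversions_mul_swap_add_one_le σ hk hlt
  refine (edist_one_le_succ (SimpleGraph.pathGraph_adj.2 (Or.inl hk))
    (ih _ (by omega) _ rfl)).trans ?_
  gcongr
  omega

lemma card_filter_lt : #({p | p.1 < p.2} : Finset (Fin n × Fin n)) = n * (n - 1) / 2 := by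
  rw [card_filter, ← univ_product_univ, sum_product_right, ← Finset.sum_range_id,
    ← Fin.sum_univ_eq_sum_range (fun i => i)]
  refine sum_congr rfl fun j _ => ?_
  rw [← card_filter, ← Fin.card_Iio j]
  congr 1
  ext i
  simp

/-- The god number of a path. -/
theorem godNumber_pathGraph (n : ℕ) :
    godNumber (SimpleGraph.pathGraph n) = ((n * (n - 1) / 2 : ℕ) : ℕ∞) := by
  rw [← card_filter_lt]
  refine le_antisymm (godNumber_le_iff.2 fun σ => (edist_pathGraph_le σ).trans ?_) ?_
  · gcongr
    exact fun p hp => by simp_all [inversions]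
  · have h : ({p | p.1 < p.2} : Finset (Fin n × Fin n)) = inversions Fin.revPerm := by
      ext p
      simp [inversions]
    rw [h]
    refine le_trans ?_ (edist_one_le_godNumber Fin.revPerm)
    refine le_edist_one_of_potential (fun σ => #(inversions σ)) ?_ ?_ _
    · refine card_eq_zero.2 (filter_eq_empty_iff.2 fun p _ hp => lt_asymm hp.1 hp.2)
    · intro σ a b hab
      rcases SimpleGraph.pathGraph_adj.1 hab with h | h
      · exact card_inversions_mul_swap_le σ h
      · rw [swap_comm]
        exact card_inversions_mul_swap_le σ h

end Path

/-! ### Cycles and displacements -/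

section Cycle

open Finset

variable {n : ℕ}

/-- The number of steps from `i` to `j` in the positive direction around the cycle. -/
def gap (i j : Fin n) : ℤ := if i ≤ j then (j : ℤ) - i else j - i + n

lemma gap_nonneg (i j : Fin n) : 0 ≤ gap i j := by
  unfold gap; split_ifs with h <;> rw [Fin.le_def] at h <;> omega

lemma gap_lt (i j : Fin n) : gap i j < n := by
  unfold gap; split_ifs with h <;> rw [Fin.le_def] at h <;> omega

lemma gap_self (i : Fin n) : gap i i = 0 := by simp [gap]

lemma gap_add_gap_of_ne {i j : Fin n} (h : i ≠ j) : gap i j + gap j i = n := by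
  rw [ne_eq, Fin.ext_iff] at h
  simp only [gap, Fin.le_def]
  split_ifs <;> omega

lemma gap_eq_add {i j k : Fin n} (h : gap i j + gap j k < n) : gap i k = gap i j + gap j k := by
  simp only [gap, Fin.le_def] at h ⊢
  split_ifs at h ⊢ <;> omega

lemma dvd_gap_sub (i j : Fin n) : (n : ℤ) ∣ gap i j - (j - i) := by
  unfold gap
  split_ifs
  · simp
  · exact ⟨1, by ring⟩

lemma eq_of_gap_eq_zero {i j : Fin n} (h : gap i j = 0) : i = j := by
  simp only [gap, Fin.le_def] at h
  rw [Fin.ext_iff]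
  split_ifs at h <;> omega

lemma gap_eq_val_sub (i j : Fin n) : gap i j = ((j - i : Fin n) : ℕ) := by
  unfold gap
  split_ifs with h
  · rw [Fin.coe_sub_iff_le.2 h, Nat.cast_sub (Fin.le_def.1 h)]
  · rw [Fin.coe_sub_iff_lt.2 (not_le.1 h)]
    omega

lemma sum_gap (i : Fin n) : ∑ j, gap i j = ∑ j : Fin n, (j : ℤ) := by
  have : NeZero n := ⟨(Fin.pos i).ne'⟩
  simp only [gap_eq_val_sub]
  exact Equiv.sum_comp (Equiv.subRight i) fun j : Fin n => (j.val : ℤ)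

lemma cycleGraph_adj_iff_gap {i j : Fin n} :
    (SimpleGraph.cycleGraph n).Adj i j ↔ gap j i = 1 ∨ gap i j = 1 := by
  rw [SimpleGraph.cycleGraph_adj', gap_eq_val_sub, gap_eq_val_sub]
  norm_cast

/-- `x` records how far the label at each vertex of the cycle has to travel to reach its home, where
the total distance is zero. -/
structure IsDisplacement (σ : Perm (Fin n)) (x : Fin n → ℤ) : Prop where
  dvd : ∀ i, (n : ℤ) ∣ i + x i - σ i
  sum_eq_zero : ∑ i, x i = 0

/-- The displacement after a move along the edge from `k` to its successor `k'`. -/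
def moveDisplacement (x : Fin n → ℤ) (k k' i : Fin n) : ℤ :=
  x (swap k k' i) + (if i = k then 1 else 0) - (if i = k' then 1 else 0)

/-- The label that steps back from `k'` to `k` has one more step to travel, the one that steps
forward has one less. -/
lemma IsDisplacement.move {σ : Perm (Fin n)} {x : Fin n → ℤ} (hx : IsDisplacement σ x)
    {k k' : Fin n} (hk : gap k k' = 1) :
    IsDisplacement (σ * swap k k') (moveDisplacement x k k') where
  dvd i := by
    have hkk : k ≠ k' := by rintro rfl; simp [gap_self] at hk
    have hd := dvd_gap_sub k k'
    rw [hk] at hd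
    rw [Perm.mul_apply, moveDisplacement]
    rcases eq_or_ne i k with rfl | h1
    · rw [swap_apply_left, if_pos rfl, if_neg hkk]
      have := dvd_add (hx.dvd k') hd
      ring_nf at this ⊢
      exact this
    rcases eq_or_ne i k' with rfl | h2
    · rw [swap_apply_right, if_pos rfl, if_neg hkk.symm]
      have := dvd_sub (hx.dvd k) hd
      ring_nf at this ⊢
      exact this
    · rw [swap_apply_of_ne_of_ne h1 h2, if_neg h1, if_neg h2]
      simpa using hx.dvd i
  sum_eq_zero := by
    simp only [moveDisplacement, sum_sub_distrib, sum_add_distrib]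
    rw [Equiv.sum_comp (swap k k') x, hx.sum_eq_zero]
    simp

lemma sum_abs_moveDisplacement_le (x : Fin n → ℤ) (k k' : Fin n) :
    ∑ i, |moveDisplacement x k k' i| ≤ ∑ i, |x i| + 2 := by
  have h : ∀ i, |moveDisplacement x k k' i| ≤
      |x (swap k k' i)| + (if i = k then 1 else 0) + (if i = k' then 1 else 0) := by
    intro i
    rw [moveDisplacement]
    split_ifs <;> grind
  refine (sum_le_sum fun i _ => h i).trans ?_
  simp only [sum_add_distrib]
  rw [Equiv.sum_comp (swap k k') fun i => |x i|]
  simp [add_assoc]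

lemma IsDisplacement.one : IsDisplacement (1 : Perm (Fin n)) 0 :=
  ⟨by simp, by simp⟩

/-- With `h = n / 2`, every displacement of the half rotation is congruent to `h` modulo `n`. Since
the total is zero, the absolute values sum to at least `2 * h * (n - h)`, and a move adds at most
two to this sum. -/
lemma le_edist_halfRotation (n : ℕ) :
    ((n / 2 * (n - n / 2) : ℕ) : ℕ∞) ≤
      (gameGraph (SimpleGraph.cycleGraph n)).edist (halfRotation n) 1 := by
  refine le_edist_one (P := fun k σ => ∃ x, IsDisplacement σ x ∧ ∑ i, |x i| ≤ 2 * k)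
    ⟨0, IsDisplacement.one, by simp⟩ ?_ ?_
  · have move : ∀ (k : ℕ) (σ : Perm (Fin n)) (a b : Fin n), gap a b = 1 →
        (∃ x, IsDisplacement σ x ∧ ∑ i, |x i| ≤ 2 * k) →
        ∃ x, IsDisplacement (σ * swap a b) x ∧ ∑ i, |x i| ≤ 2 * ((k + 1 : ℕ) : ℤ) := by
      rintro k σ a b hab ⟨x, hx, hk⟩
      refine ⟨_, hx.move hab, (sum_abs_moveDisplacement_le x a b).trans ?_⟩
      push_cast
      linarith
    intro k σ a b hab h
    rcases cycleGraph_adj_iff_gap.1 hab with h' | h'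
    · rw [swap_comm]
      exact move k σ b a h' h
    · exact move k σ a b h' h
  · rintro k ⟨x, hx, hk⟩
    rcases Nat.eq_zero_or_pos n with rfl | hn
    · simp
    obtain ⟨h, hh⟩ : ∃ h, h = n / 2 := ⟨_, rfl⟩
    rw [← hh]
    have hdvd : ∀ i, (n : ℤ) ∣ x i - h := by
      intro i
      have h1 := hx.dvd i
      rw [halfRotation_apply, ← hh] at h1
      push_cast at h1
      have h2 : (n : ℤ) ∣ (i + h) - ((i : ℤ) + h) % n := Int.dvd_self_sub_emod
      have := dvd_sub h1 h2
      ring_nf at this ⊢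
      exact this
    choose m hm using hdvd
    have hsum : ∑ i, m i = -h := by
      have h1 : ∑ i, (x i - h) = ∑ i, (n : ℤ) * m i := sum_congr rfl fun i _ => hm i
      rw [sum_sub_distrib, hx.sum_eq_zero, ← mul_sum] at h1
      simp only [sum_const, card_univ, Fintype.card_fin, nsmul_eq_mul, zero_sub] at h1
      have hn' : (n : ℤ) ≠ 0 := by exact_mod_cast hn.ne'
      refine mul_left_cancel₀ hn' ?_
      rw [← h1]
      ring
    -- The left side is the linear function of `m i` that agrees with `|h + n * m i|` at `0` and
    -- `-1`. Its sum depends only on the sum of the `m i`.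
    have habs : ∀ i, (h : ℤ) - m i * (n - 2 * h) ≤ |x i| := by
      intro i
      have hxi : x i = h + n * m i := by linarith [hm i]
      have h0 : (0 : ℤ) ≤ h := by positivity
      have h1 : (2 : ℤ) * h ≤ n := by omega
      rcases le_or_gt 0 (m i) with hmi | hmi
      · refine le_trans ?_ (le_abs_self _)
        nlinarith
      · refine le_trans ?_ (neg_le_abs _)
        nlinarith
    have := sum_le_sum fun i (_ : i ∈ univ) => habs i
    rw [sum_sub_distrib, ← sum_mul, hsum] at this
    simp only [sum_const, card_univ, Fintype.card_fin, nsmul_eq_mul] at this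
    have hle : h ≤ n := by omega
    zify [hle]
    nlinarith

/-- The label at `i` has to overtake the label at `j`. -/
def Crosses (x : Fin n → ℤ) (i j : Fin n) : Prop := gap i j < x i - x j

instance (x : Fin n → ℤ) : DecidableRel (Crosses x) :=
  fun i j => inferInstanceAs (Decidable (gap i j < x i - x j))

instance (x : Fin n → ℤ) : Std.Irrefl (Crosses x) :=
  ⟨fun i h => by simp [Crosses, gap_self] at h⟩

/-- The two gaps add up to less than `x i - x k ≤ n`, so the way from `i` over `j` to `k` is less
than a full turn. -/
lemma isTrans_crosses {x : Fin n → ℤ} (hx : ∀ i j, x i - x j ≤ n) :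
    IsTrans (Fin n) (Crosses x) :=
  ⟨fun i j k h1 h2 => by
    unfold Crosses at *
    have := hx i k
    rw [gap_eq_add (j := j) (by omega)]
    omega⟩

/-- Summing `key` over `j` cancels the gaps, because `σ` is a bijection, and the `x j`, because
their total is zero; `n * x i` remains. -/
lemma IsDisplacement.imbalance_eq {σ : Perm (Fin n)} {x : Fin n → ℤ} (hx : IsDisplacement σ x)
    (hr : ∀ i j, x i - x j ≤ n) (i : Fin n) : imbalance (Crosses x) univ i = x i := by
  have hn : 0 < (n : ℤ) := by exact_mod_cast Fin.pos i
  have key : ∀ j, (n : ℤ) * ((if Crosses x i j then 1 else 0) - (if Crosses x j i then 1 else 0)) =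
      gap (σ i) (σ j) - gap i j + (x i - x j) := by
    intro j
    rcases eq_or_ne i j with rfl | hij
    · simp [gap_self]
    obtain ⟨q, hq⟩ : (n : ℤ) ∣ gap (σ i) (σ j) - gap i j + (x i - x j) := by
      have := ((dvd_gap_sub (σ i) (σ j)).sub (dvd_gap_sub i j)).add
        ((hx.dvd i).sub (hx.dvd j))
      ring_nf at this ⊢
      exact this
    rw [hq]
    congr 1
    have h1 := gap_nonneg (σ i) (σ j)
    have h2 := gap_lt (σ i) (σ j)
    have h3 := gap_add_gap_of_ne hij
    have h4 := gap_nonneg i j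
    have h4' := gap_nonneg j i
    have h5 := hr i j
    have h6 := hr j i
    have h7 : 0 < gap (σ i) (σ j) :=
      lt_of_le_of_ne h1 fun h => hij (σ.injective (eq_of_gap_eq_zero h.symm))
    -- The two gaps lie strictly between `0` and `n`, and `|x i - x j| ≤ n`, so `n * q` lies
    -- strictly between `-2 * n` and `2 * n`.
    have hq1 : q < 2 := by
      by_contra! h
      nlinarith
    have hq2 : -2 < q := by
      by_contra! h
      nlinarith
    unfold Crosses
    obtain rfl | rfl | rfl : q = -1 ∨ q = 0 ∨ q = 1 := by omega
    all_goals split_ifs <;> omega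
  have hsum : (n : ℤ) * imbalance (Crosses x) univ i = n * x i := by
    have e : imbalance (Crosses x) univ i =
        ∑ j, ((if Crosses x i j then 1 else 0) - (if Crosses x j i then 1 else 0)) := by
      rw [imbalance, card_filter, card_filter, sum_sub_distrib]
      push_cast
      rfl
    rw [e, mul_sum, sum_congr rfl fun j _ => key j]
    simp only [sum_add_distrib, sum_sub_distrib]
    rw [Equiv.sum_comp σ (gap (σ i)), sum_gap, sum_gap, hx.sum_eq_zero]
    simp
  exact mul_left_cancel₀ hn.ne' hsum

lemma comparableCount_univ {α : Type*} [Fintype α] [DecidableEq α] (r : α → α → Prop)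
    [DecidableRel r] :
    comparableCount r univ = #({p | r p.1 p.2} : Finset (α × α)) := by
  rw [card_filter, ← univ_product_univ, sum_product, comparableCount]
  exact sum_congr rfl fun i _ => card_filter _ _

lemma moveDisplacement_swap (x : Fin n → ℤ) (k k' i : Fin n) :
    moveDisplacement x k k' (swap k k' i) =
      x i + (if i = k' then 1 else 0) - (if i = k then 1 else 0) := by
  simp only [moveDisplacement, swap_apply_self, swap_apply_eq_iff, swap_apply_left,
    swap_apply_right]

/-- The sign of this quantity decides whether `i` crosses `j`, so a move affects only the crossing
of the two labels it swaps. -/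
lemma gap_swap_sub_moveDisplacement {x : Fin n → ℤ} {k k' i j : Fin n} (hk : gap k k' = 1)
    (h : (i, j) ≠ (k, k')) (h' : (i, j) ≠ (k', k)) :
    gap (swap k k' i) (swap k k' j) -
        (moveDisplacement x k k' (swap k k' i) - moveDisplacement x k k' (swap k k' j)) =
      gap i j - (x i - x j) := by
  rcases eq_or_ne i j with rfl | hij
  · simp [gap_self]
  rw [moveDisplacement_swap, moveDisplacement_swap]
  simp only [ne_eq, Prod.mk.injEq, not_and, Fin.ext_iff] at h h' hij
  simp only [gap, swap_apply_def, Fin.le_def, Fin.ext_iff] at hk ⊢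
  split_ifs at hk ⊢ <;> omega

/-- As `gap k k' = 1`, the hypothesis `hd` says that `k` crosses `k'`. After the move neither of the
two labels crosses the other; one direction uses `hr`. -/
lemma comparableCount_moveDisplacement {x : Fin n → ℤ} (hr : ∀ i j, x i - x j ≤ n)
    {k k' : Fin n} (hk : gap k k' = 1) (hd : x k' + 1 < x k) :
    comparableCount (Crosses (moveDisplacement x k k')) univ + 1 ≤
      comparableCount (Crosses x) univ := by
  have hkk : k ≠ k' := by rintro rfl; simp [gap_self] at hk
  rw [comparableCount_univ, comparableCount_univ]
  have e : #({p | Crosses (moveDisplacement x k k') p.1 p.2} : Finset (Fin n × Fin n)) =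
      #({p | Crosses (moveDisplacement x k k') (swap k k' p.1) (swap k k' p.2)} :
        Finset (Fin n × Fin n)) := by
    refine card_equiv ((swap k k').prodCongr (swap k k')) fun p => ?_
    simp
  have hmem : (k, k') ∈ ({p | Crosses x p.1 p.2} : Finset (Fin n × Fin n)) := by
    simp only [mem_filter, mem_univ, true_and]
    unfold Crosses
    omega
  rw [e, ← card_erase_add_one hmem]
  gcongr
  rintro ⟨i, j⟩ hp
  simp only [mem_filter, mem_univ, true_and] at hp
  unfold Crosses at hp
  have hkk' := gap_add_gap_of_ne hkk
  have hkn := hr k k'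
  have h1 : (i, j) ≠ (k, k') := by
    intro h
    obtain ⟨rfl, rfl⟩ := Prod.mk.injEq _ _ _ _ ▸ h
    rw [moveDisplacement_swap, moveDisplacement_swap, swap_apply_left, swap_apply_right] at hp
    simp only [hkk, hkk.symm, if_true, if_false] at hp
    omega
  have h2 : (i, j) ≠ (k', k) := by
    intro h
    obtain ⟨rfl, rfl⟩ := Prod.mk.injEq _ _ _ _ ▸ h
    rw [moveDisplacement_swap, moveDisplacement_swap, swap_apply_left, swap_apply_right] at hp
    simp only [hkk, hkk.symm, if_true, if_false] at hp
    omega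
  have h3 := gap_swap_sub_moveDisplacement (x := x) hk h1 h2
  refine mem_erase.2 ⟨h1, ?_⟩
  simp only [mem_filter, mem_univ, true_and]
  unfold Crosses
  omega

/-- The two changed displacements stay between `x k'` and `x k`. -/
lemma moveDisplacement_sub_le {x : Fin n → ℤ} (hr : ∀ i j, x i - x j ≤ n) {k k' : Fin n}
    (hd : x k' + 1 < x k) (i j : Fin n) :
    moveDisplacement x k k' i - moveDisplacement x k k' j ≤ n := by
  have hkk : k ≠ k' := by rintro rfl; omega
  have h : ∀ i, ∃ a b, x a ≤ moveDisplacement x k k' i ∧ moveDisplacement x k k' i ≤ x b := by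
    intro i
    unfold moveDisplacement
    rcases eq_or_ne i k with rfl | h1
    · refine ⟨k', i, ?_⟩
      simp [hkk]
      omega
    rcases eq_or_ne i k' with rfl | h2
    · refine ⟨i, k, ?_⟩
      simp [hkk.symm]
      omega
    · refine ⟨i, i, ?_⟩
      simp [swap_apply_of_ne_of_ne h1 h2, h1, h2]
  obtain ⟨-, b, -, hb⟩ := h i
  obtain ⟨a, -, ha, -⟩ := h j
  have := hr b a
  omega

/-- Equality in `hd` would give two neighbours the same label. So `x` never decreases around the
cycle, hence is constant, hence zero because its total is zero. -/
lemma IsDisplacement.eq_one_of_forall_le {σ : Perm (Fin n)} {x : Fin n → ℤ}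
    (hx : IsDisplacement σ x) (hd : ∀ k k', gap k k' = 1 → x k ≤ x k' + 1) : σ = 1 := by
  rcases lt_or_ge n 2 with hn | hn
  · have : Subsingleton (Fin n) := Fin.subsingleton_iff_le_one.2 (by omega)
    exact Subsingleton.elim _ _
  have : NeZero n := ⟨by omega⟩
  have hgap : ∀ k : Fin n, gap k (k + 1) = 1 := by
    intro k
    rw [gap_eq_val_sub, add_sub_cancel_left, Fin.val_one', Nat.mod_eq_of_lt (by omega)]
    rfl
  have hle : ∀ k : Fin n, 0 ≤ x (k + 1) - x k := by
    intro k
    have h1 := hd k (k + 1) (hgap k)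
    have h2 : x k ≠ x (k + 1) + 1 := by
      intro h
      have h3 := ((hx.dvd k).sub (hx.dvd (k + 1))).add (dvd_gap_sub (σ k) (σ (k + 1)))
      have h4 := dvd_gap_sub k (k + 1)
      rw [hgap] at h4
      have h5 : (n : ℤ) ∣ gap (σ k) (σ (k + 1)) := by
        have e : gap (σ k) (σ (k + 1)) = (k + x k - σ k - ((k + 1 : Fin n) + x (k + 1) - σ (k + 1)) +
            (gap (σ k) (σ (k + 1)) - (σ (k + 1) - σ k))) - (1 - ((k + 1 : Fin n) - k)) := by
          rw [h]
          ring
        rw [e]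
        exact h3.sub h4
      have h6 := Int.eq_zero_of_dvd_of_nonneg_of_lt (gap_nonneg _ _) (gap_lt _ _) h5
      have h7 := σ.injective (eq_of_gap_eq_zero h6)
      have h8 := hgap k
      rw [← h7, gap_self] at h8
      omega
    omega
  have hstep : ∀ k : Fin n, x (k + 1) = x k := by
    have h0 : ∑ k : Fin n, (x (k + 1) - x k) = 0 := by
      rw [sum_sub_distrib, sub_eq_zero]
      exact Equiv.sum_comp (Equiv.addRight (1 : Fin n)) x
    intro k
    have := (sum_eq_zero_iff_of_nonneg fun k _ => hle k).1 h0 k (mem_univ k)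
    omega
  have hconst : ∀ k, x k = x 0 := by
    rintro ⟨m, hm⟩
    induction m with
    | zero => rfl
    | succ m ih =>
      rw [← ih (by omega), ← hstep ⟨m, by omega⟩]
      congr 1
      simp [Fin.ext_iff, Fin.val_add, Nat.mod_eq_of_lt hm]
  have hzero : x 0 = 0 := by
    have := hx.sum_eq_zero
    rw [sum_congr rfl fun k _ => hconst k] at this
    simp only [sum_const, card_univ, Fintype.card_fin, nsmul_eq_mul, mul_eq_zero] at this
    omega
  ext i
  have h1 := hx.dvd i
  rw [hconst, hzero, add_zero] at h1
  have h2 : (n : ℤ) ∣ gap (σ i) i := by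
    simpa using (dvd_gap_sub (σ i) i).add h1
  rw [eq_of_gap_eq_zero (Int.eq_zero_of_dvd_of_nonneg_of_lt (gap_nonneg _ _) (gap_lt _ _) h2)]
  rfl

lemma IsDisplacement.edist_le {σ : Perm (Fin n)} {x : Fin n → ℤ} (hx : IsDisplacement σ x)
    (hr : ∀ i j, x i - x j ≤ n) :
    (gameGraph (SimpleGraph.cycleGraph n)).edist σ 1 ≤ comparableCount (Crosses x) univ := by
  induction hN : comparableCount (Crosses x) univ using Nat.strong_induction_on
    generalizing σ x with
  | _ N ih =>
  by_cases hd : ∀ k k', gap k k' = 1 → x k ≤ x k' + 1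
  · simp [hx.eq_one_of_forall_le hd]
  push Not at hd
  obtain ⟨k, k', hk, hd⟩ := hd
  have hle := comparableCount_moveDisplacement hr hk hd
  refine (edist_one_le_succ (cycleGraph_adj_iff_gap.2 (Or.inr hk))
    (ih _ (by omega) (hx.move hk) (moveDisplacement_sub_le hr hd) rfl)).trans ?_
  gcongr
  omega

/-- A displacement with the least sum of squares has this property; `σ i - i` shows that
displacements exist. -/
lemma exists_isDisplacement_sub_le (σ : Perm (Fin n)) :
    ∃ x, IsDisplacement σ x ∧ ∀ i j, x i - x j ≤ n := by
  have hne : ∃ N : ℕ, ∃ x, IsDisplacement σ x ∧ ∑ i, x i ^ 2 = (N : ℤ) := by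
    refine ⟨(∑ i, ((σ i : ℤ) - i) ^ 2).toNat, fun i => (σ i : ℤ) - i, ⟨by simp, ?_⟩, ?_⟩
    · rw [sum_sub_distrib, Equiv.sum_comp σ fun i : Fin n => (i : ℤ), sub_self]
    · rw [Int.toNat_of_nonneg (sum_nonneg fun i _ => sq_nonneg _)]
  classical
  obtain ⟨x, hx, hN⟩ := Nat.find_spec hne
  refine ⟨x, hx, ?_⟩
  by_contra! hbig
  obtain ⟨a, b, hab⟩ := hbig
  have hn : 0 < (n : ℤ) := by exact_mod_cast Fin.pos a
  have hne' : a ≠ b := by rintro rfl; omega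
  -- shifting the two extreme displacements by a full turn makes the sum of squares smaller
  obtain ⟨y, hyx⟩ : ∃ y : Fin n → ℤ, ∀ i,
      y i = x i - (if i = a then (n : ℤ) else 0) + (if i = b then (n : ℤ) else 0) :=
    ⟨_, fun _ => rfl⟩
  have hy : IsDisplacement σ y := by
    refine ⟨fun i => ?_, ?_⟩
    · have h1 : (n : ℤ) ∣ (if i = a then (n : ℤ) else 0) := by split_ifs <;> simp
      have h2 : (n : ℤ) ∣ (if i = b then (n : ℤ) else 0) := by split_ifs <;> simp
      have e : i + y i - σ i = i + x i - σ i - (if i = a then (n : ℤ) else 0) +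
          (if i = b then (n : ℤ) else 0) := by
        rw [hyx]
        ring
      rw [e]
      exact ((hx.dvd i).sub h1).add h2
    · simp [hyx, sum_add_distrib, sum_sub_distrib, hx.sum_eq_zero]
  have hysq : ∑ i, y i ^ 2 = ∑ i, x i ^ 2 + 2 * n * (n - (x a - x b)) := by
    have : ∀ i, y i ^ 2 = x i ^ 2 + (if i = a then (n : ℤ) * (n - 2 * x a) else 0) +
        (if i = b then (n : ℤ) * (n + 2 * x b) else 0) := by
      intro i
      rcases eq_or_ne i a with rfl | h1
      · simp only [hyx, if_true, hne', if_false]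
        ring
      rcases eq_or_ne i b with rfl | h2
      · simp only [hyx, if_true, h1, if_false]
        ring
      · simp [hyx, h1, h2]
    rw [sum_congr rfl fun i _ => this i, sum_add_distrib, sum_add_distrib]
    simp only [sum_ite_eq', mem_univ, if_true]
    ring
  have hlt : ∑ i, y i ^ 2 < (Nat.find hne : ℤ) := by
    rw [hysq, hN]
    nlinarith
  have hpos : 0 ≤ ∑ i, y i ^ 2 := sum_nonneg fun i _ => sq_nonneg _
  refine Nat.find_min hne (m := (∑ i, y i ^ 2).toNat) (by omega) ⟨y, hy, ?_⟩
  rw [Int.toNat_of_nonneg hpos]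

lemma edist_cycleGraph_le (σ : Perm (Fin n)) :
    (gameGraph (SimpleGraph.cycleGraph n)).edist σ 1 ≤ (n ^ 2 / 4 : ℕ) := by
  obtain ⟨x, hx, hr⟩ := exists_isDisplacement_sub_le σ
  have := isTrans_crosses hr
  refine (hx.edist_le hr).trans ?_
  have h := comparableCount_le (r := Crosses x) n univ (by simp) fun i _ j _ => by
    rw [hx.imbalance_eq hr, hx.imbalance_eq hr]
    exact hr i j
  gcongr
  omega

/-- Links the closed formula to the product that bounds the half rotation from below. -/
lemma sq_add_one_div_four (n : ℕ) : (n ^ 2 + 1) / 4 = n / 2 * (n - n / 2) := by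
  obtain ⟨h, rfl | rfl⟩ := n.even_or_odd'
  · have h1 : 2 * h / 2 = h := by omega
    have h2 : 2 * h - h = h := by omega
    have h3 : (2 * h) ^ 2 = 4 * (h * h) := by ring
    rw [h1, h2, h3]
    omega
  · have h1 : (2 * h + 1) / 2 = h := by omega
    have h2 : 2 * h + 1 - h = h + 1 := by omega
    have h3 : (2 * h + 1) ^ 2 = 4 * (h * (h + 1)) + 1 := by ring
    rw [h1, h2, h3]
    omega

/-- The half rotation is at distance `⌊(n ^ 2 + 1) / 4⌋` from the solved position. -/
theorem edist_halfRotation (n : ℕ) :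
    (gameGraph (SimpleGraph.cycleGraph n)).edist (halfRotation n) 1 =
      (((n ^ 2 + 1) / 4 : ℕ) : ℕ∞) := by
  refine le_antisymm ((edist_cycleGraph_le _).trans ?_) ?_
  · gcongr
    omega
  · rw [sq_add_one_div_four]
    exact le_edist_halfRotation n

/-- The god number of a cycle. -/
theorem godNumber_cycleGraph (n : ℕ) :
    godNumber (SimpleGraph.cycleGraph n) = (((n ^ 2 + 1) / 4 : ℕ) : ℕ∞) := by
  refine le_antisymm (godNumber_le_iff.2 fun σ => (edist_cycleGraph_le σ).trans ?_) ?_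
  · gcongr
    omega
  · rw [← edist_halfRotation]
    exact edist_one_le_godNumber _

end Cycle

end TranspositionGame

theorem mainTheorem5 :
    -- complete graph on `n` vertices
    (∀ n : ℕ, 1 ≤ n →
      TranspositionGame.godNumber (SimpleGraph.completeGraph (Fin n)) = ((n - 1 : ℕ) : ℕ∞)) ∧
    -- path on `n` vertices
    (∀ n : ℕ, 1 ≤ n →
      TranspositionGame.godNumber (SimpleGraph.pathGraph n) = ((n * (n - 1) / 2 : ℕ) : ℕ∞)) ∧
    -- cycle on `n` vertices; the half rotation is at maximal distance from the identity
    (∀ n : ℕ, 3 ≤ n →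
      TranspositionGame.godNumber (SimpleGraph.cycleGraph n) = (((n ^ 2 + 1) / 4 : ℕ) : ℕ∞) ∧
      (TranspositionGame.gameGraph (SimpleGraph.cycleGraph n)).edist
        (TranspositionGame.halfRotation n) 1 = (((n ^ 2 + 1) / 4 : ℕ) : ℕ∞)) ∧
    -- star with `n` leaves
    (∀ n : ℕ, 1 ≤ n →
      TranspositionGame.godNumber (TranspositionGame.starGraph n) = ((3 * n / 2 : ℕ) : ℕ∞)) ∧
    -- wheel with `n` rim vertices
    (∀ n : ℕ, 3 ≤ n →
      (n : ℕ∞) ≤ TranspositionGame.godNumber (TranspositionGame.wheelGraph n) ∧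
      TranspositionGame.godNumber (TranspositionGame.wheelGraph n) ≤
        ((3 * n / 2 : ℕ) : ℕ∞)) := by
  refine ⟨fun n hn => ?_, fun n _ => TranspositionGame.godNumber_pathGraph n,
    fun n _ => ⟨TranspositionGame.godNumber_cycleGraph n, TranspositionGame.edist_halfRotation n⟩,
    fun n _ => TranspositionGame.godNumber_starGraph n,
    fun n _ => ⟨TranspositionGame.le_godNumber_wheelGraph n,
      TranspositionGame.godNumber_wheelGraph_le n⟩⟩
  have : Nonempty (Fin n) := ⟨⟨0, hn⟩⟩
  simpa using TranspositionGame.godNumber_top (V := Fin n)
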